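/- Let $(p_n)_{n\ge1}$ be a sequence in $[0,1]$. Define break points $a_{n,k}$ ($n\ge0$, $0\le k\le n+1$) by $a_{n,0}=0$, $a_{n,n+1}=1$ and, for $n\ge1$ and $1\le k\le n$, $$a_{n,k}=p_n\,a_{n-1,k-1}+(1-p_n)\,a_{n-1,k}$$ (deterministic stratified fragmentation with erasure), and let $g_n=\frac1n\sum_{k=1}^n\delta_{a_{n,k}}$ be their empirical distribution. Set $s_n=\sum_{k=1}^n p_k(1-p_k)$ and assume that $s_n\to\infty$ as $n\to\infty$. Let $\Phi$ be the standard normal distribution function and $Q=\Phi^{-1}:(0,1)\to\mathbb R$ its quantile function. Then $Q$ is differentiable on $(0,1)$ with $Q'\ge0$, the measure $Q'(u)\,du$ is a Radon measure on $(0,1)$, and the sequence $(n g_n/\sqrt{s_n})$ of Radon measures on $(0,1)$ converges vaguely on $(0,1)$ to it, that is, $$\frac{n}{\sqrt{s_n}}\int_{(0,1)} f\,dg_n\to\int_0^1 f(u)\,Q'(u)\,du$$ for every continuous $f:(0,1)\to\mathbb R$ with compact support in $(0,1)$. Moreover, for all $0<x\le y<1$, $$\frac{n\,g_n([x,y])}{\sqrt{s_n}}\to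 Q(y)-Q(x)\quad\text{as } n\to\infty.$$ -/

import Mathlib

open MeasureTheory ProbabilityTheory Filter Topology Set
open scoped CompactlySupported ENNReal

namespace FragErasure

/-- The break points `a_{n,k}` of the fragmentation-with-erasure process with splitting proportions
`p n k` (only `1 ≤ k ≤ n` matters): `a_{n,0} = 0`, `a_{n,n+1} = 1` and
`a_{n,k} = p_{n,k} a_{n-1,k-1} + (1 - p_{n,k}) a_{n-1,k}` for `1 ≤ k ≤ n`.
(The value is set to `1` for the irrelevant indices `k > n + 1`.) -/
noncomputable def breakPoint (p : ℕ → ℕ → ℝ) : ℕ → ℕ → ℝ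
  | _, 0 => 0
  | 0, _ + 1 => 1
  | n + 1, k + 1 =>
    if k + 1 ≤ n + 1 then
      p (n + 1) (k + 1) * breakPoint p n k + (1 - p (n + 1) (k + 1)) * breakPoint p n (k + 1)
    else 1

/-- The empirical distribution `g_n = (1/n) ∑_{k=1}^n δ_{a_{n,k}}` of the break points. -/
noncomputable def empirical (p : ℕ → ℕ → ℝ) (n : ℕ) : Measure ℝ :=
  (n : ℝ≥0∞)⁻¹ • ∑ k ∈ Finset.Icc 1 n, Measure.dirac (breakPoint p n k)

/-- Stratified splitting proportions: `p_{n,k} = p_n` for all `k`. -/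
def stratified (p : ℕ → ℝ) : ℕ → ℕ → ℝ := fun n _ => p n

/-- `s_n = ∑_{k=1}^n p_k (1 - p_k)`. -/
noncomputable def s (p : ℕ → ℝ) (n : ℕ) : ℝ := ∑ k ∈ Finset.Icc 1 n, p k * (1 - p k)

/-- The measure `n g_n / √(s_n)`, restricted to the open interval `(0,1)`, in the stratified case. -/
noncomputable def rescaled (p : ℕ → ℝ) (n : ℕ) : Measure (Ioo (0 : ℝ) 1) :=
  ENNReal.ofReal (n / √(s p n)) • (empirical (stratified p) n).comap Subtype.val

/-- The standard normal distribution function `Φ`. -/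
noncomputable def normalCDF (t : ℝ) : ℝ := cdf (gaussianReal 0 1) t

/-- The standard normal quantile function `Q = Φ⁻¹` (used on `(0,1)` only). -/
noncomputable def Q : ℝ → ℝ := Function.invFun normalCDF

/-- The measure on `(0,1)` with density `Q'` with respect to the Lebesgue measure. -/
noncomputable def limitMeasure : Measure (Ioo (0 : ℝ) 1) :=
  ((volume : Measure ℝ).comap Subtype.val).withDensity fun u => ENNReal.ofReal (deriv Q u)

/-- Vague convergence of a sequence of measures: convergence of the integrals of all continuous
functions with compact support. -/
def VagueTendsto {α : Type*} [TopologicalSpace α] [MeasurableSpace α]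
    (μ : ℕ → Measure α) (ν : Measure α) : Prop :=
  ∀ f : C_c(α, ℝ), Tendsto (fun n => ∫ x, f x ∂(μ n)) atTop (𝓝 (∫ x, f x ∂ν))

theorem normalCDF_strictMono : StrictMono normalCDF := by
  intro a b hab
  have hm := measure_cdf (gaussianReal 0 1)
  have h1 : (cdf (gaussianReal 0 1)).measure (Ioc a b) ≠ 0 := by
    rw [hm]
    intro h
    have := gaussianReal_absolutelyContinuous' 0 (one_ne_zero) h
    rw [Real.volume_Ioc] at this
    simp at this
    linarith
  rw [StieltjesFunction.measure_Ioc] at h1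
  simp at h1
  exact h1

theorem normalCDF_continuous : Continuous normalCDF := by
  rw [continuous_iff_continuousAt]
  intro x
  have hm := measure_cdf (gaussianReal 0 1)
  have : NullSingletonClass (gaussianReal 0 1) := nullSingletonClass_gaussianReal one_ne_zero
  have h := (cdf (gaussianReal 0 1)).measure_singleton x
  rw [hm, measure_singleton] at h
  have h2 := (monotone_cdf (gaussianReal 0 1)).leftLim_le (le_refl x)
  have h3 := ENNReal.ofReal_eq_zero.mp h.symm
  refine (monotone_cdf (gaussianReal 0 1)).continuousAt_iff_leftLim_eq_rightLim.mpr ?_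
  rw [StieltjesFunction.rightLim_eq]
  linarith

/-- `Q` is the two-sided inverse of `Φ : ℝ → (0,1)`. -/
theorem normalCDF_Q {u : ℝ} (hu : u ∈ Ioo (0 : ℝ) 1) : normalCDF (Q u) = u := by
  apply Function.invFun_eq
  have h0 := ((tendsto_cdf_atBot (gaussianReal 0 1)).eventually_le_const hu.1).exists
  have h1 := ((tendsto_cdf_atTop (gaussianReal 0 1)).eventually_const_le hu.2).exists
  exact mem_range_of_exists_le_of_exists_ge normalCDF_continuous h0 h1

theorem Q_normalCDF (t : ℝ) : Q (normalCDF t) = t :=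
  Function.leftInverse_invFun normalCDF_strictMono.injective t

end FragErasure

namespace FragErasure

/-! The recursion for the break points is the one obtained by conditioning a sum `S_n` of
independent Bernoulli(`p_i`) variables on its last term, so `a_{n,k} = P(S_n < k)`
(`breakPoint_stratified`). The central limit theorem (`tendsto_bernoulliSumLaw_real`) then says that
`a_{n,k}` crosses the level `u` at an index `k = m_n + Q(u) √s_n + o(√s_n)`, where `m_n` is the mean
of `S_n`. Counting integers between the crossings of `x` and `y` gives the interval statement
(`tendsto_mul_empirical_real_div`).

Since `Q(y) - Q(x)` is the integral of `Q'`, the limit measure gives `(x, y]` the same mass. Vague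
convergence follows by Riemann sums on a compact subinterval
(`tendsto_setIntegral_of_tendsto_measureReal_Ioc`). -/

/-! ### Bernoulli sums and the break points. -/

/-- The law of a sum of `n` independent Bernoulli variables with parameters `p 1, …, p n`. -/
noncomputable def bernoulliSumLaw (p : ℕ → ℝ) : ℕ → Measure ℝ
  | 0 => Measure.dirac 0
  | n + 1 => ENNReal.ofReal (1 - p (n + 1)) • bernoulliSumLaw p n +
      ENNReal.ofReal (p (n + 1)) • (bernoulliSumLaw p n).map (· + 1)

theorem isProbabilityMeasure_bernoulliSumLaw
    {p : ℕ → ℝ} (hp : ∀ n, 1 ≤ n → p n ∈ Icc (0 : ℝ) 1) (n : ℕ) :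
    IsProbabilityMeasure (bernoulliSumLaw p n) := by
  induction n with
  | zero => rw [bernoulliSumLaw]; infer_instance
  | succ n ih =>
    have h := hp (n + 1) (by omega)
    have : IsProbabilityMeasure ((bernoulliSumLaw p n).map (· + 1)) :=
      Measure.isProbabilityMeasure_map (by fun_prop)
    refine ⟨?_⟩
    simp only [bernoulliSumLaw, Measure.add_apply, Measure.smul_apply, measure_univ, smul_eq_mul,
      mul_one]
    rw [← ENNReal.ofReal_add (by linarith [h.2]) h.1]
    simp

theorem bernoulliSumLaw_real_succ
    {p : ℕ → ℝ} (hp : ∀ n, 1 ≤ n → p n ∈ Icc (0 : ℝ) 1) (n : ℕ) (x : ℝ) :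
    (bernoulliSumLaw p (n + 1)).real (Iio (x + 1)) =
      p (n + 1) * (bernoulliSumLaw p n).real (Iio x) +
        (1 - p (n + 1)) * (bernoulliSumLaw p n).real (Iio (x + 1)) := by
  have h := hp (n + 1) (by omega)
  have := isProbabilityMeasure_bernoulliSumLaw hp n
  have : IsProbabilityMeasure ((bernoulliSumLaw p n).map (· + 1)) :=
    Measure.isProbabilityMeasure_map (by fun_prop)
  have hx : (fun z : ℝ => z + 1) ⁻¹' Iio (x + 1) = Iio x := by ext; simp
  rw [bernoulliSumLaw, measureReal_add_apply (by simp [ENNReal.mul_eq_top]) (by simp [ENNReal.mul_eq_top]),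
    measureReal_ennreal_smul_apply, measureReal_ennreal_smul_apply,
    map_measureReal_apply (by fun_prop) measurableSet_Iio, hx,
    ENNReal.toReal_ofReal h.1, ENNReal.toReal_ofReal (by linarith [h.2])]
  ring

/-- The strict half-line `Iio` matters: `P(S_n < 0) = 0` and `P(S_n < n + 1) = 1` match the boundary
values of the break points. -/
theorem bernoulliSumLaw_real_of_nonpos
    {p : ℕ → ℝ} (hp : ∀ n, 1 ≤ n → p n ∈ Icc (0 : ℝ) 1) (n : ℕ) {x : ℝ} (hx : x ≤ 0) :
    (bernoulliSumLaw p n).real (Iio x) = 0 := by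
  induction n generalizing x with
  | zero => simp [bernoulliSumLaw, measureReal_def, hx]
  | succ n ih =>
    have := bernoulliSumLaw_real_succ hp n (x - 1)
    rw [sub_add_cancel, ih hx, ih (by linarith)] at this
    simpa using this

theorem bernoulliSumLaw_real_of_lt
    {p : ℕ → ℝ} (hp : ∀ n, 1 ≤ n → p n ∈ Icc (0 : ℝ) 1) (n : ℕ) {x : ℝ} (hx : (n : ℝ) < x) :
    (bernoulliSumLaw p n).real (Iio x) = 1 := by
  induction n generalizing x with
  | zero =>
    have hx : (0 : ℝ) < x := by simpa using hx
    simp [bernoulliSumLaw, measureReal_def, hx]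
  | succ n ih =>
    have := bernoulliSumLaw_real_succ hp n (x - 1)
    push_cast at hx
    rw [sub_add_cancel, ih (by linarith), ih (by linarith)] at this
    rw [this]; ring

/-- The break points are the values of the distribution function of a Bernoulli sum. -/
theorem breakPoint_stratified
    {p : ℕ → ℝ} (hp : ∀ n, 1 ≤ n → p n ∈ Icc (0 : ℝ) 1) (n k : ℕ) :
    breakPoint (stratified p) n k = (bernoulliSumLaw p n).real (Iio (k : ℝ)) := by
  induction n generalizing k with
  | zero =>
    cases k with
    | zero => rw [breakPoint, bernoulliSumLaw_real_of_nonpos hp _ (by simp)]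
    | succ k => rw [breakPoint, bernoulliSumLaw_real_of_lt hp _ (by push_cast; positivity)]
  | succ n ih =>
    cases k with
    | zero => rw [breakPoint, bernoulliSumLaw_real_of_nonpos hp _ (by simp)]
    | succ k =>
      rw [breakPoint]
      split_ifs with h
      · rw [ih, ih]
        push_cast
        rw [bernoulliSumLaw_real_succ hp]
        rfl
      · rw [bernoulliSumLaw_real_of_lt hp _ (by exact_mod_cast (by omega : n + 1 < k + 1))]

/-! ### Characteristic functions and the central limit theorem. -/

theorem charFun_bernoulliSumLaw_succ
    {p : ℕ → ℝ} (hp : ∀ n, 1 ≤ n → p n ∈ Icc (0 : ℝ) 1) (n : ℕ) (u : ℝ) :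
    charFun (bernoulliSumLaw p (n + 1)) u =
      (1 - p (n + 1) + p (n + 1) * Complex.exp (u * Complex.I)) *
        charFun (bernoulliSumLaw p n) u := by
  have h := hp (n + 1) (by omega)
  have := isProbabilityMeasure_bernoulliSumLaw hp n
  have : IsProbabilityMeasure ((bernoulliSumLaw p n).map (· + 1)) :=
    Measure.isProbabilityMeasure_map (by fun_prop)
  have hint (μ : Measure ℝ) [IsProbabilityMeasure μ] (c : ℝ) :
      Integrable (fun x : ℝ => Complex.exp (u * x * Complex.I)) (ENNReal.ofReal c • μ) := by
    refine Integrable.smul_measure ?_ ENNReal.ofReal_ne_top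
    refine Integrable.of_bound (by fun_prop) 1 (ae_of_all _ fun x => ?_)
    rw [← Complex.ofReal_mul, Complex.norm_exp_ofReal_mul_I]
  rw [bernoulliSumLaw, charFun_apply_real, integral_add_measure (hint _ _) (hint _ _),
    integral_smul_measure, integral_smul_measure, ← charFun_apply_real, ← charFun_apply_real,
    charFun_map_add_const, ENNReal.toReal_ofReal h.1, ENNReal.toReal_ofReal (by linarith [h.2])]
  simp
  ring

theorem norm_exp_mul_I_sub_le {x : ℝ} (hx : |x| ≤ 1) :
    ‖Complex.exp (x * Complex.I) - (1 + x * Complex.I - x ^ 2 / 2)‖ ≤ |x| ^ 3 := by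
  have h := Complex.exp_bound (x := x * Complex.I) (by simpa using hx) (n := 3) (by norm_num)
  simp only [Finset.sum_range_succ, Finset.sum_range_zero, mul_pow, Complex.I_sq, norm_mul,
    Complex.norm_I, Complex.norm_real, Real.norm_eq_abs, mul_one] at h
  norm_num [Nat.factorial] at h
  have h0 : 0 ≤ |x| ^ 3 := by positivity
  calc _ = _ := by congr 1; ring
    _ ≤ _ := h
    _ ≤ _ := by linarith

/-- Centring kills the linear term, so both functions equal `1 - q(1-q)u²/2` up to third order.
Keeping the factor `q(1-q)` in the error is essential: the errors then sum to a multiple of `s_n`,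
not of `n`. -/
theorem norm_centered_bernoulli_sub_le {q u : ℝ} (hq : q ∈ Icc (0 : ℝ) 1) (hu : |u| ≤ 1) :
    ‖((1 - q : ℝ) * Complex.exp ((-(q * u) : ℝ) * Complex.I) +
      q * Complex.exp (((1 - q) * u : ℝ) * Complex.I)) -
      Real.exp (-(q * (1 - q) * u ^ 2 / 2))‖ ≤ 2 * (q * (1 - q)) * |u| ^ 3 := by
  obtain ⟨h0, h1⟩ := hq
  have h1' : 0 ≤ 1 - q := by linarith
  have hu0 := abs_nonneg u
  have A1 := norm_exp_mul_I_sub_le (x := -(q * u)) (by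
    rw [abs_neg, abs_mul, abs_of_nonneg h0]; nlinarith)
  have A2 := norm_exp_mul_I_sub_le (x := (1 - q) * u) (by
    rw [abs_mul, abs_of_nonneg h1']; nlinarith)
  rw [abs_neg, abs_mul, abs_of_nonneg h0] at A1
  rw [abs_mul, abs_of_nonneg h1'] at A2
  set v := q * (1 - q) * u ^ 2 / 2 with hv
  have hqq : 0 ≤ q * (1 - q) := by positivity
  have hqq1 : q * (1 - q) ≤ 1 := by nlinarith
  have hv0 : 0 ≤ v := by positivity
  have hu2 : u ^ 2 ≤ 1 := by rw [← sq_abs]; nlinarith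
  have hv1 : v ≤ 1 := by nlinarith
  have A3 := Real.abs_exp_sub_one_sub_id_le (x := -v) (by rw [abs_neg, abs_of_nonneg hv0]; exact hv1)
  have A3' : ‖(Real.exp (-v) : ℂ) - (1 - v : ℝ)‖ ≤ q * (1 - q) * |u| ^ 3 := by
    rw [← Complex.ofReal_sub, Complex.norm_real, Real.norm_eq_abs]
    calc _ = _ := by congr 1; ring
      _ ≤ _ := A3
      _ ≤ _ := by
        have e1 : (-v) ^ 2 = (q * (1 - q)) * |u| ^ 3 * ((q * (1 - q)) * |u| / 4) := by
          rw [hv, ← sq_abs u]; ring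
        rw [e1]
        exact mul_le_of_le_one_right (by positivity) (by nlinarith)
  set e1 := Complex.exp ((-(q * u) : ℝ) * Complex.I)
  set e2 := Complex.exp (((1 - q) * u : ℝ) * Complex.I)
  have key : ((1 - q : ℝ) * e1 + q * e2) - Real.exp (-v) =
      (1 - q : ℝ) * (e1 - (1 + (-(q * u) : ℝ) * Complex.I - (-(q * u) : ℝ) ^ 2 / 2)) +
      (q : ℝ) * (e2 - (1 + ((1 - q) * u : ℝ) * Complex.I - ((1 - q) * u : ℝ) ^ 2 / 2)) -
      (Real.exp (-v) - (1 - v : ℝ)) := by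
    rw [hv]; push_cast; ring
  rw [key]
  refine (norm_sub_le _ _).trans ((add_le_add ((norm_add_le _ _).trans (add_le_add
    (norm_mul_le _ _) (norm_mul_le _ _))) A3').trans ?_)
  rw [Complex.norm_real, Complex.norm_real, Real.norm_of_nonneg h0, Real.norm_of_nonneg h1']
  have B1 := mul_le_mul_of_nonneg_left A1 h1'
  have B2 := mul_le_mul_of_nonneg_left A2 h0
  -- The absolute third central moment of a Bernoulli variable is at most its variance.
  have B3 : (1 - q) * (q * |u|) ^ 3 + q * ((1 - q) * |u|) ^ 3 ≤ q * (1 - q) * |u| ^ 3 := by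
    have : (1 - q) * (q * |u|) ^ 3 + q * ((1 - q) * |u|) ^ 3 =
      q * (1 - q) * |u| ^ 3 * (1 - 2 * (q * (1 - q))) := by ring
    rw [this]
    exact mul_le_of_le_one_right (by positivity) (by linarith)
  linarith

theorem s_succ (p : ℕ → ℝ) (n : ℕ) : s p (n + 1) = s p n + p (n + 1) * (1 - p (n + 1)) := by
  rw [s, s, Finset.sum_Icc_succ_top (by omega)]

/-- The mean of a Bernoulli sum. -/
noncomputable def meanSum (p : ℕ → ℝ) (n : ℕ) : ℝ := ∑ k ∈ Finset.Icc 1 n, p k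

theorem meanSum_succ (p : ℕ → ℝ) (n : ℕ) : meanSum p (n + 1) = meanSum p n + p (n + 1) := by
  rw [meanSum, meanSum, Finset.sum_Icc_succ_top (by omega)]

theorem s_nonneg
    {p : ℕ → ℝ} (hp : ∀ n, 1 ≤ n → p n ∈ Icc (0 : ℝ) 1) (n : ℕ) : 0 ≤ s p n :=
  Finset.sum_nonneg fun k hk => by
    have h := hp k (Finset.mem_Icc.1 hk).1
    exact mul_nonneg h.1 (by linarith [h.2])

/-- Replacing one factor at a time makes the errors add, because all factors have modulus at most 1.
-/
theorem norm_charFun_centered_sub_le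
    {p : ℕ → ℝ} (hp : ∀ n, 1 ≤ n → p n ∈ Icc (0 : ℝ) 1) (n : ℕ) {u : ℝ} (hu : |u| ≤ 1) :
    ‖Complex.exp ((-(meanSum p n * u) : ℝ) * Complex.I) * charFun (bernoulliSumLaw p n) u -
      Real.exp (-(s p n * u ^ 2 / 2))‖ ≤ 2 * s p n * |u| ^ 3 := by
  induction n with
  | zero => simp [meanSum, s, bernoulliSumLaw]
  | succ n ih =>
    have h := hp (n + 1) (by omega)
    have hφ := norm_centered_bernoulli_sub_le h hu
    set q := p (n + 1) with hq
    set φ : ℂ := ((1 - q : ℝ) * Complex.exp ((-(q * u) : ℝ) * Complex.I) +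
      q * Complex.exp (((1 - q) * u : ℝ) * Complex.I)) with hφdef
    have hφ1 : ‖φ‖ ≤ 1 := by
      refine (norm_add_le _ _).trans ?_
      rw [norm_mul, norm_mul, Complex.norm_exp_ofReal_mul_I, Complex.norm_exp_ofReal_mul_I,
        Complex.norm_real, Complex.norm_real, Real.norm_of_nonneg h.1,
        Real.norm_of_nonneg (by linarith [h.2])]
      linarith
    have hE : Complex.exp ((-(meanSum p (n + 1) * u) : ℝ) * Complex.I) *
        charFun (bernoulliSumLaw p (n + 1)) u =
        φ * (Complex.exp ((-(meanSum p n * u) : ℝ) * Complex.I) *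
          charFun (bernoulliSumLaw p n) u) := by
      have e1 : Complex.exp ((-(meanSum p (n + 1) * u) : ℝ) * Complex.I) =
          Complex.exp ((-(q * u) : ℝ) * Complex.I) *
            Complex.exp ((-(meanSum p n * u) : ℝ) * Complex.I) := by
        rw [← Complex.exp_add, meanSum_succ]
        congr 1
        push_cast
        ring
      have e2 : Complex.exp (((1 - q) * u : ℝ) * Complex.I) =
          Complex.exp ((-(q * u) : ℝ) * Complex.I) * Complex.exp (u * Complex.I) := by
        rw [← Complex.exp_add]
        congr 1
        push_cast
        ring
      rw [charFun_bernoulliSumLaw_succ hp, e1, hφdef, e2]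
      push_cast
      ring
    have hexp : (Real.exp (-(s p (n + 1) * u ^ 2 / 2)) : ℂ) =
        Real.exp (-(q * (1 - q) * u ^ 2 / 2)) * Real.exp (-(s p n * u ^ 2 / 2)) := by
      rw [← Complex.ofReal_mul, ← Real.exp_add, s_succ]
      congr 2
      ring
    rw [hE, hexp]
    set E := Complex.exp ((-(meanSum p n * u) : ℝ) * Complex.I) * charFun (bernoulliSumLaw p n) u
    set ψ : ℂ := (Real.exp (-(q * (1 - q) * u ^ 2 / 2)) : ℂ)
    have he1 : ‖(Real.exp (-(s p n * u ^ 2 / 2)) : ℂ)‖ ≤ 1 := by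
      rw [Complex.norm_real, Real.norm_of_nonneg (Real.exp_pos _).le, Real.exp_le_one_iff]
      have := s_nonneg hp n
      have : 0 ≤ s p n * u ^ 2 / 2 := by positivity
      linarith
    set e : ℂ := (Real.exp (-(s p n * u ^ 2 / 2)) : ℂ)
    have : φ * E - ψ * e = φ * (E - e) + (φ - ψ) * e := by ring
    rw [this]
    refine (norm_add_le _ _).trans ?_
    rw [norm_mul, norm_mul, s_succ]
    have i1 := mul_le_of_le_one_left (norm_nonneg (E - e)) hφ1
    have i2 := mul_le_of_le_one_right (norm_nonneg (φ - ψ)) he1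
    rw [← hq]
    linarith

/-- At `u = t / √s_n` the Gaussian exponent is exactly `-t²/2`, and the error `2 s_n |u|³` equals
`2|t|³ / √s_n`. -/
theorem tendsto_charFun_normalized
    {p : ℕ → ℝ} (hp : ∀ n, 1 ≤ n → p n ∈ Icc (0 : ℝ) 1)
    (hs : Tendsto (s p) atTop atTop) (t : ℝ) :
    Tendsto (fun n => charFun
      ((bernoulliSumLaw p n).map fun x => (√(s p n))⁻¹ * (x + -meanSum p n)) t) atTop
      (𝓝 (charFun (gaussianReal 0 1) t)) := by
  have hsq : Tendsto (fun n => √(s p n)) atTop atTop := Real.tendsto_sqrt_atTop.comp hs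
  have hmap (n : ℕ) : charFun
      ((bernoulliSumLaw p n).map fun x => (√(s p n))⁻¹ * (x + -meanSum p n)) t =
      Complex.exp ((-(meanSum p n * ((√(s p n))⁻¹ * t)) : ℝ) * Complex.I) *
        charFun (bernoulliSumLaw p n) ((√(s p n))⁻¹ * t) := by
    rw [charFun_map_mul_comp (by fun_prop), charFun_map_add_const, mul_comm]
    congr 2
    simp
    ring
  simp_rw [hmap]
  have hg : charFun (gaussianReal 0 1) t = (Real.exp (-(t ^ 2 / 2)) : ℂ) := by
    rw [charFun_gaussianReal]
    push_cast
    congr 1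
    simp
  rw [hg]
  have h0 : Tendsto (fun n => (√(s p n))⁻¹ * t) atTop (𝓝 0) := by
    simpa using hsq.inv_tendsto_atTop.mul_const t
  have hbound : Tendsto (fun n => 2 * |t| ^ 3 * (√(s p n))⁻¹) atTop (𝓝 0) := by
    simpa using hsq.inv_tendsto_atTop.const_mul (2 * |t| ^ 3)
  rw [tendsto_iff_norm_sub_tendsto_zero]
  refine squeeze_zero' (Eventually.of_forall fun _ => norm_nonneg _) ?_ hbound
  have hev : ∀ᶠ n in atTop, |(√(s p n))⁻¹ * t| ≤ 1 := by
    have := h0.abs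
    rw [abs_zero] at this
    exact this.eventually_le_const one_pos
  filter_upwards [hev, hs.eventually_gt_atTop 0] with n hn hpos
  have h := norm_charFun_centered_sub_le hp n hn
  have hr : 0 < √(s p n) := Real.sqrt_pos.2 hpos
  have hss : s p n = √(s p n) ^ 2 := (Real.sq_sqrt hpos.le).symm
  have e1 : s p n * ((√(s p n))⁻¹ * t) ^ 2 / 2 = t ^ 2 / 2 := by
    rw [mul_pow, inv_pow, Real.sq_sqrt hpos.le]
    field_simp
  have e2 : 2 * s p n * |(√(s p n))⁻¹ * t| ^ 3 = 2 * |t| ^ 3 * (√(s p n))⁻¹ := by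
    rw [abs_mul, abs_of_pos (inv_pos.2 hr)]
    nth_rewrite 1 [hss]
    field_simp
  rwa [e1, e2] at h

/-- The **central limit theorem** for sums of independent Bernoulli variables. -/
theorem tendsto_bernoulliSumLaw_real
    {p : ℕ → ℝ} (hp : ∀ n, 1 ≤ n → p n ∈ Icc (0 : ℝ) 1)
    (hs : Tendsto (s p) atTop atTop) (t : ℝ) :
    Tendsto (fun n => (bernoulliSumLaw p n).real (Iio (meanSum p n + t * √(s p n)))) atTop
      (𝓝 (normalCDF t)) := by
  have hprob := isProbabilityMeasure_bernoulliSumLaw hp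
  have hprob' (n : ℕ) : IsProbabilityMeasure
      ((bernoulliSumLaw p n).map fun x => (√(s p n))⁻¹ * (x + -meanSum p n)) :=
    Measure.isProbabilityMeasure_map (by fun_prop)
  let Z (n : ℕ) : ProbabilityMeasure ℝ :=
    ⟨(bernoulliSumLaw p n).map fun x => (√(s p n))⁻¹ * (x + -meanSum p n), hprob' n⟩
  let N : ProbabilityMeasure ℝ := ⟨gaussianReal 0 1, inferInstance⟩
  have hZ : Tendsto Z atTop (𝓝 N) :=
    ProbabilityMeasure.tendsto_of_tendsto_charFun (tendsto_charFun_normalized hp hs)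
  have : NullSingletonClass (gaussianReal 0 1) := nullSingletonClass_gaussianReal one_ne_zero
  have hIio := ProbabilityMeasure.tendsto_measure_of_null_frontier_of_tendsto' hZ (E := Iio t)
    (by rw [frontier_Iio]; exact measure_singleton (μ := gaussianReal 0 1) t)
  have hreal := (ENNReal.tendsto_toReal (measure_ne_top _ _)).comp hIio
  have hN : ((N : Measure ℝ) (Iio t)).toReal = normalCDF t := by
    rw [normalCDF, cdf_eq_real, measureReal_def,
      ← measure_congr (Iio_ae_eq_Iic (μ := gaussianReal 0 1))]
    rfl
  rw [hN] at hreal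
  refine hreal.congr' ?_
  filter_upwards [hs.eventually_gt_atTop 0] with n hpos
  have hr : 0 < √(s p n) := Real.sqrt_pos.2 hpos
  change ((bernoulliSumLaw p n).map _).real (Iio t) = _
  rw [map_measureReal_apply (by fun_prop) measurableSet_Iio]
  congr 1
  ext x
  simp only [mem_preimage, mem_Iio]
  rw [inv_mul_lt_iff₀ hr]
  constructor <;> intro h <;> linarith

/-! ### Smoothness of the normal quantile function. -/

theorem normalCDF_eq_integral (t : ℝ) : normalCDF t = ∫ x in Iic t, gaussianPDFReal 0 1 x := by
  rw [normalCDF, cdf_eq_real, measureReal_def, gaussianReal_apply_eq_integral _ one_ne_zero,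
    ENNReal.toReal_ofReal]
  exact integral_nonneg fun x => gaussianPDFReal_nonneg _ _ _

theorem continuous_gaussianPDFReal : Continuous (gaussianPDFReal 0 1) := by
  unfold gaussianPDFReal
  fun_prop

theorem hasDerivAt_normalCDF (t : ℝ) : HasDerivAt normalCDF (gaussianPDFReal 0 1 t) t := by
  have hint := integrable_gaussianPDFReal 0 1
  have h (x : ℝ) : normalCDF x = normalCDF 0 + ∫ y in (0 : ℝ)..x, gaussianPDFReal 0 1 y := by
    rw [normalCDF_eq_integral, normalCDF_eq_integral,
      ← intervalIntegral.integral_Iic_sub_Iic hint.integrableOn hint.integrableOn]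
    ring
  rw [funext h]
  exact (continuous_gaussianPDFReal.integral_hasStrictDerivAt 0 t).hasDerivAt.const_add _

theorem normalCDF_mem_Ioo (t : ℝ) : normalCDF t ∈ Ioo (0 : ℝ) 1 :=
  ⟨(cdf_nonneg _ (t - 1)).trans_lt (normalCDF_strictMono (by linarith)),
    (normalCDF_strictMono (by linarith)).trans_le (cdf_le_one _ (t + 1))⟩

theorem Q_lt_iff {u : ℝ} (hu : u ∈ Ioo (0 : ℝ) 1) {t : ℝ} : Q u < t ↔ u < normalCDF t := by
  rw [← normalCDF_strictMono.lt_iff_lt, normalCDF_Q hu]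

theorem lt_Q_iff {u : ℝ} (hu : u ∈ Ioo (0 : ℝ) 1) {t : ℝ} : t < Q u ↔ normalCDF t < u := by
  rw [← normalCDF_strictMono.lt_iff_lt, normalCDF_Q hu]

theorem Q_le_Q {x y : ℝ} (hx : x ∈ Ioo (0 : ℝ) 1) (hy : y ∈ Ioo (0 : ℝ) 1) (hxy : x ≤ y) :
    Q x ≤ Q y := by
  rw [← normalCDF_strictMono.le_iff_le, normalCDF_Q hx, normalCDF_Q hy]
  exact hxy

theorem continuousAt_Q {u : ℝ} (hu : u ∈ Ioo (0 : ℝ) 1) : ContinuousAt Q u := by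
  -- `Q` has no meaning outside `(0,1)`, so comparisons are made only near `u`.
  have hmem : ∀ᶠ v in 𝓝 u, v ∈ Ioo (0 : ℝ) 1 := isOpen_Ioo.mem_nhds hu
  refine tendsto_order.2 ⟨fun a ha => ?_, fun a ha => ?_⟩
  · filter_upwards [hmem, eventually_gt_nhds ((lt_Q_iff hu).1 ha)] with v hv h
    exact (lt_Q_iff hv).2 h
  · filter_upwards [hmem, eventually_lt_nhds ((Q_lt_iff hu).1 ha)] with v hv h
    exact (Q_lt_iff hv).2 h

theorem hasDerivAt_Q {u : ℝ} (hu : u ∈ Ioo (0 : ℝ) 1) :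
    HasDerivAt Q (gaussianPDFReal 0 1 (Q u))⁻¹ u := by
  refine HasDerivAt.of_local_left_inverse (continuousAt_Q hu) (hasDerivAt_normalCDF (Q u))
    (gaussianPDFReal_pos _ _ _ one_ne_zero).ne' ?_
  filter_upwards [isOpen_Ioo.mem_nhds hu] with v hv
  exact normalCDF_Q hv

theorem deriv_Q_nonneg {u : ℝ} (hu : u ∈ Ioo (0 : ℝ) 1) : 0 ≤ deriv Q u := by
  rw [(hasDerivAt_Q hu).deriv]
  exact inv_nonneg.2 (gaussianPDFReal_nonneg _ _ _)

theorem continuousOn_deriv_Q : ContinuousOn (deriv Q) (Ioo 0 1) := by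
  have h : ContinuousOn (fun u => (gaussianPDFReal 0 1 (Q u))⁻¹) (Ioo 0 1) := fun u hu =>
    ((continuous_gaussianPDFReal.continuousAt.comp (continuousAt_Q hu)).inv₀
      (gaussianPDFReal_pos _ _ _ one_ne_zero).ne').continuousWithinAt
  exact h.congr fun u hu => (hasDerivAt_Q hu).deriv

/-! ### Radon measures on the open interval and their masses. -/

theorem regular_limitMeasure : limitMeasure.Regular := by
  have : LocallyCompactSpace (Ioo (0 : ℝ) 1) := isOpen_Ioo.locallyCompactSpace
  have : IsLocallyFiniteMeasure ((volume : Measure ℝ).comap (Subtype.val : Ioo (0 : ℝ) 1 → ℝ)) := by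
    have : IsFiniteMeasure ((volume : Measure ℝ).comap (Subtype.val : Ioo (0 : ℝ) 1 → ℝ)) := by
      refine ⟨?_⟩
      rw [comap_subtype_coe_apply measurableSet_Ioo, image_univ, Subtype.range_coe]
      exact measure_Ioo_lt_top
    infer_instance
  -- A continuous density is locally bounded; on `(0,1)` local finiteness already implies
  -- regularity.
  have : IsLocallyFiniteMeasure limitMeasure :=
    IsLocallyFiniteMeasure.withDensity_ofReal (continuousOn_iff_continuous_domRestrict.1
      continuousOn_deriv_Q)
  infer_instance

theorem isFiniteMeasure_empirical (p : ℕ → ℕ → ℝ) (n : ℕ) : IsFiniteMeasure (empirical p n) := by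
  rcases n with _ | n
  · simp only [empirical, Finset.Icc_eq_empty_of_lt zero_lt_one, Finset.sum_empty, smul_zero]
    infer_instance
  · have : IsFiniteMeasure (∑ k ∈ Finset.Icc 1 (n + 1), Measure.dirac (breakPoint p (n + 1) k)) :=
      inferInstance
    exact Measure.smul_finite _ (by simp)

theorem isFiniteMeasure_rescaled (p : ℕ → ℝ) (n : ℕ) : IsFiniteMeasure (rescaled p n) := by
  have := isFiniteMeasure_empirical (stratified p) n
  have : IsFiniteMeasure
      ((empirical (stratified p) n).comap (Subtype.val : Ioo (0 : ℝ) 1 → ℝ)) := by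
    refine ⟨?_⟩
    rw [comap_subtype_coe_apply measurableSet_Ioo]
    finiteness
  exact Measure.smul_finite _ ENNReal.ofReal_ne_top

theorem regular_rescaled (p : ℕ → ℝ) (n : ℕ) : (rescaled p n).Regular := by
  have : LocallyCompactSpace (Ioo (0 : ℝ) 1) := isOpen_Ioo.locallyCompactSpace
  have := isFiniteMeasure_rescaled p n
  infer_instance

theorem integral_deriv_Q {x y : ℝ} (hx : 0 < x) (hxy : x ≤ y) (hy : y < 1) :
    ∫ u in x..y, deriv Q u = Q y - Q x := by
  have hsub : uIcc x y ⊆ Ioo 0 1 := by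
    rw [uIcc_of_le hxy]
    exact fun u hu => ⟨hx.trans_le hu.1, hu.2.trans_lt hy⟩
  exact intervalIntegral.integral_deriv_eq_sub (fun u hu => (hasDerivAt_Q (hsub hu)).differentiableAt)
    (continuousOn_deriv_Q.mono hsub).intervalIntegrable

theorem map_limitMeasure_Ioc {x y : ℝ} (hx : 0 < x) (hxy : x ≤ y) (hy : y < 1) :
    limitMeasure.map Subtype.val (Ioc x y) = ENNReal.ofReal (Q y - Q x) := by
  have hsub : Icc x y ⊆ Ioo 0 1 := fun u hu => ⟨hx.trans_le hu.1, hu.2.trans_lt hy⟩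
  have hint : IntegrableOn (deriv Q) (Ioc x y) :=
    ((continuousOn_deriv_Q.mono hsub).integrableOn_Icc).mono_set Ioc_subset_Icc_self
  have hnn : 0 ≤ᵐ[volume.restrict (Ioc x y)] deriv Q := by
    filter_upwards [ae_restrict_mem measurableSet_Ioc] with u hu
    exact deriv_Q_nonneg (hsub (Ioc_subset_Icc_self hu))
  rw [Measure.map_apply measurable_subtype_coe measurableSet_Ioc, limitMeasure,
    withDensity_apply _ (measurable_subtype_coe measurableSet_Ioc),
    ← integral_deriv_Q hx hxy hy, intervalIntegral.integral_of_le hxy,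
    ofReal_integral_eq_lintegral_ofReal hint hnn,
    (MeasurableEmbedding.subtype_coe measurableSet_Ioo).restrict_comap,
    lintegral_subtype_comap (f := fun u => ENNReal.ofReal (deriv Q u)) measurableSet_Ioo,
    Measure.restrict_restrict measurableSet_Ioo,
    Subtype.image_preimage_coe, inter_eq_right.2 (Ioc_subset_Icc_self.trans hsub),
    inter_eq_right.2 (Ioc_subset_Icc_self.trans hsub)]

/-! ### Counting break points in an interval. -/

theorem card_le_of_mem_Icc {A : Finset ℕ} {α β : ℝ} (hαβ : α ≤ β)
    (h : ∀ k ∈ A, α ≤ (k : ℝ) ∧ (k : ℝ) ≤ β) : (A.card : ℝ) ≤ β - α + 1 := by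
  have hsub : A.map Nat.castEmbedding ⊆ Finset.Icc ⌈α⌉ ⌊β⌋ := by
    intro z hz
    obtain ⟨k, hk, rfl⟩ := Finset.mem_map.1 hz
    rw [Finset.mem_Icc, Int.ceil_le, Int.le_floor]
    simpa using h k hk
  have hcard := Finset.card_le_card hsub
  rw [Finset.card_map, Int.card_Icc] at hcard
  have h1 := Int.le_ceil α
  have h2 := Int.floor_le β
  -- The cardinality of an integer interval is a truncated difference; `α ≤ β` covers the truncated
  -- case.
  rcases le_total 0 (⌊β⌋ + 1 - ⌈α⌉) with h0 | h0
  · have : (A.card : ℤ) ≤ ⌊β⌋ + 1 - ⌈α⌉ := by omega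
    have : (A.card : ℝ) ≤ ⌊β⌋ + 1 - ⌈α⌉ := by exact_mod_cast this
    linarith
  · have : A.card = 0 := by omega
    rw [this]
    push_cast
    linarith

/-- The hypothesis ranges over `ℤ` because `α` may be negative a priori; nonnegativity of `k` is
left to the application. -/
theorem le_card_of_Icc_subset {A : Finset ℕ} {α β : ℝ}
    (h : ∀ k : ℤ, α ≤ (k : ℝ) → (k : ℝ) ≤ β → ∃ j ∈ A, (j : ℤ) = k) :
    β - α - 1 ≤ (A.card : ℝ) := by
  have hsub : Finset.Icc ⌈α⌉ ⌊β⌋ ⊆ A.map Nat.castEmbedding := by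
    intro z hz
    rw [Finset.mem_Icc, Int.ceil_le, Int.le_floor] at hz
    obtain ⟨j, hj, hjz⟩ := h z hz.1 hz.2
    exact Finset.mem_map.2 ⟨j, hj, hjz⟩
  have hcard := Finset.card_le_card hsub
  rw [Finset.card_map, Int.card_Icc] at hcard
  have h1 := Int.ceil_lt_add_one α
  have h2 := Int.lt_floor_add_one β
  have : ⌊β⌋ + 1 - ⌈α⌉ ≤ (A.card : ℤ) := by omega
  have : (⌊β⌋ : ℝ) + 1 - ⌈α⌉ ≤ A.card := by exact_mod_cast this
  linarith

open scoped Classical in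
theorem mul_empirical_real (p : ℕ → ℕ → ℝ) (n : ℕ) {S : Set ℝ} (hS : MeasurableSet S) :
    (n : ℝ) * (empirical p n).real S =
      ((Finset.Icc 1 n).filter fun k => breakPoint p n k ∈ S).card := by
  rcases eq_or_ne n 0 with rfl | hn
  · simp
  · have h : ∑ k ∈ Finset.Icc 1 n, Measure.dirac (breakPoint p n k) S =
        (((Finset.Icc 1 n).filter fun k => breakPoint p n k ∈ S).card : ℝ≥0∞) := by
      simp [Measure.dirac_apply' _ hS, indicator_apply]
    rw [measureReal_def, empirical, Measure.smul_apply, Measure.finsetSum_apply, h]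
    simp [hn]

/-- Endpoints do not affect the limit, so one statement serves `Icc` in the interval claim and `Ioc`
in the vague limit. -/
theorem tendsto_mul_empirical_real_div {p : ℕ → ℝ} (hp : ∀ n, 1 ≤ n → p n ∈ Icc (0 : ℝ) 1)
    (hs : Tendsto (s p) atTop atTop) {x y : ℝ} (hx : 0 < x) (hxy : x ≤ y) (hy : y < 1)
    {S : Set ℝ} (hS : MeasurableSet S) (hS1 : Ioo x y ⊆ S) (hS2 : S ⊆ Icc x y) :
    Tendsto (fun n : ℕ => (n : ℝ) * (empirical (stratified p) n).real S / √(s p n)) atTop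
      (𝓝 (Q y - Q x)) := by
  classical
  have hxI : x ∈ Ioo (0 : ℝ) 1 := ⟨hx, hxy.trans_lt hy⟩
  have hyI : y ∈ Ioo (0 : ℝ) 1 := ⟨hx.trans_le hxy, hy⟩
  have hsq : Tendsto (fun n => √(s p n)) atTop atTop := Real.tendsto_sqrt_atTop.comp hs
  have hprob := isProbabilityMeasure_bernoulliSumLaw hp
  have hF (n : ℕ) {u v : ℝ} (h : u ≤ v) :
      (bernoulliSumLaw p n).real (Iio u) ≤ (bernoulliSumLaw p n).real (Iio v) :=
    measureReal_mono (Iio_subset_Iio h)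
  rw [Metric.tendsto_atTop']
  suffices H : ∀ ε > 0, ∀ᶠ n : ℕ in atTop,
      dist ((n : ℝ) * (empirical (stratified p) n).real S / √(s p n)) (Q y - Q x) < ε by
    intro ε hε
    obtain ⟨N, hN⟩ := eventually_atTop.1 (H ε hε)
    exact ⟨N, fun n hn => hN n hn.le⟩
  intro δ hδ
  -- Each endpoint costs `ε √s_n`; the third `ε` absorbs the rounding error 1, as `1 < ε √s_n`
  -- eventually.
  obtain ⟨ε, hε, rfl⟩ : ∃ ε > 0, δ = 3 * ε := ⟨δ / 3, by positivity, by ring⟩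
  have hlt {u : ℝ} (hu : u ∈ Ioo (0 : ℝ) 1) : ∀ᶠ n in atTop,
      (bernoulliSumLaw p n).real (Iio (meanSum p n + (Q u - ε) * √(s p n))) < u :=
    (tendsto_bernoulliSumLaw_real hp hs (Q u - ε)).eventually_lt_const
      ((lt_Q_iff hu).1 (by linarith))
  have hgt {u : ℝ} (hu : u ∈ Ioo (0 : ℝ) 1) : ∀ᶠ n in atTop,
      u < (bernoulliSumLaw p n).real (Iio (meanSum p n + (Q u + ε) * √(s p n))) :=
    (tendsto_bernoulliSumLaw_real hp hs (Q u + ε)).eventually_const_lt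
      ((Q_lt_iff hu).1 (by linarith))
  filter_upwards [hlt hxI, hgt hxI, hlt hyI, hgt hyI, hsq.eventually_gt_atTop ε⁻¹]
    with n h1 h2 h3 h4 h5
  have hr : 0 < √(s p n) := (inv_pos.2 hε).trans h5
  have h5' : 1 < ε * √(s p n) := by rwa [inv_lt_iff_one_lt_mul₀' hε] at h5
  rw [mul_empirical_real _ _ hS]
  set A := (Finset.Icc 1 n).filter fun k => breakPoint (stratified p) n k ∈ S with hA
  have hQ := Q_le_Q hxI hyI hxy
  have hup : (A.card : ℝ) ≤ (meanSum p n + (Q y + ε) * √(s p n)) -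
      (meanSum p n + (Q x - ε) * √(s p n)) + 1 := by
    refine card_le_of_mem_Icc (by nlinarith) fun k hk => ?_
    have hkS := hS2 (Finset.mem_filter.1 hk).2
    rw [breakPoint_stratified hp] at hkS
    constructor <;> by_contra! hcon
    · exact absurd (hF n hcon.le) (by linarith [hkS.1])
    · exact absurd (hF n hcon.le) (by linarith [hkS.2])
  have hlow : (meanSum p n + (Q y - ε) * √(s p n)) -
      (meanSum p n + (Q x + ε) * √(s p n)) - 1 ≤ (A.card : ℝ) := by
    refine le_card_of_Icc_subset fun k hk1 hk2 => ?_
    have g1 := h2.trans_le (hF n hk1)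
    have g2 := (hF n hk2).trans_lt h3
    -- The value at `k` lies strictly between `x > 0` and `y < 1`, which forces `1 ≤ k ≤ n`.
    have hk0 : 0 < k := by
      by_contra! hcon
      rw [bernoulliSumLaw_real_of_nonpos hp n (by exact_mod_cast hcon)] at g1
      linarith
    lift k to ℕ using hk0.le
    have hkn : k ≤ n := by
      by_contra! hcon
      rw [bernoulliSumLaw_real_of_lt hp n (by exact_mod_cast hcon)] at g2
      linarith
    refine ⟨k, Finset.mem_filter.2 ⟨Finset.mem_Icc.2 ⟨by omega, hkn⟩, hS1 ?_⟩, rfl⟩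
    rw [breakPoint_stratified hp]
    exact ⟨by simpa using g1, by simpa using g2⟩
  rw [Real.dist_eq, abs_lt, lt_sub_iff_add_lt, sub_lt_iff_lt_add, lt_div_iff₀ hr, div_lt_iff₀ hr]
  constructor <;> nlinarith

/-! ### From masses of intervals to vague convergence. -/

theorem integrableOn_Ioc_of_continuousOn {μ : Measure ℝ} {f : ℝ → ℝ} {a b : ℝ}
    (hμ : μ (Ioc a b) ≠ ∞) (hf : ContinuousOn f (Icc a b)) : IntegrableOn f (Ioc a b) μ := by
  obtain ⟨C, hC⟩ := isCompact_Icc.exists_bound_of_continuousOn hf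
  have : IsFiniteMeasure (μ.restrict (Ioc a b)) := isFiniteMeasure_restrict.2 hμ
  refine Integrable.of_bound
    ((hf.mono Ioc_subset_Icc_self).aestronglyMeasurable measurableSet_Ioc) C ?_
  filter_upwards [ae_restrict_mem measurableSet_Ioc] with x hx
  exact hC x (Ioc_subset_Icc_self hx)

theorem abs_setIntegral_sub_sum_le {μ : Measure ℝ} {f : ℝ → ℝ} {ε : ℝ} {t : ℕ → ℝ}
    (ht : Monotone t) {m : ℕ} (hμ : μ (Ioc (t 0) (t m)) ≠ ∞)
    (hf : IntegrableOn f (Ioc (t 0) (t m)) μ)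
    (hosc : ∀ i < m, ∀ x ∈ Ioc (t i) (t (i + 1)), |f x - f (t i)| ≤ ε) :
    |∫ x in Ioc (t 0) (t m), f x ∂μ -
      ∑ i ∈ Finset.range m, f (t i) * μ.real (Ioc (t i) (t (i + 1)))| ≤
      ε * μ.real (Ioc (t 0) (t m)) := by
  induction m with
  | zero => simp
  | succ m ih =>
    have hU : Ioc (t 0) (t m) ∪ Ioc (t m) (t (m + 1)) = Ioc (t 0) (t (m + 1)) :=
      Ioc_union_Ioc_eq_Ioc (ht (Nat.zero_le _)) (ht (Nat.le_succ _))
    have hD : Disjoint (Ioc (t 0) (t m)) (Ioc (t m) (t (m + 1))) := by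
      rw [Ioc_disjoint_Ioc]
      simp [ht (Nat.le_succ m)]
    have hsub1 : Ioc (t 0) (t m) ⊆ Ioc (t 0) (t (m + 1)) := hU ▸ subset_union_left
    have hsub2 : Ioc (t m) (t (m + 1)) ⊆ Ioc (t 0) (t (m + 1)) := hU ▸ subset_union_right
    have hμ1 := measure_ne_top_of_subset hsub1 hμ
    have hμ2 := measure_ne_top_of_subset hsub2 hμ
    have hf1 := hf.mono_set hsub1
    have hf2 := hf.mono_set hsub2
    have ih := ih hμ1 hf1 fun i hi => hosc i (by omega)
    have hlast : |∫ x in Ioc (t m) (t (m + 1)), f x ∂μ -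
        f (t m) * μ.real (Ioc (t m) (t (m + 1)))| ≤ ε * μ.real (Ioc (t m) (t (m + 1))) := by
      have hc : IntegrableOn (fun _ => f (t m)) (Ioc (t m) (t (m + 1))) μ :=
        integrableOn_const hμ2
      have : ∫ x in Ioc (t m) (t (m + 1)), f x ∂μ - f (t m) * μ.real (Ioc (t m) (t (m + 1))) =
          ∫ x in Ioc (t m) (t (m + 1)), (f x - f (t m)) ∂μ := by
        rw [integral_sub hf2 hc, setIntegral_const, smul_eq_mul, mul_comm]
      rw [this, ← Real.norm_eq_abs]
      exact norm_setIntegral_le_of_norm_le_const hμ2.lt_top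
        fun x hx => hosc m (Nat.lt_succ_self m) x hx
    rw [← hU, setIntegral_union hD measurableSet_Ioc hf1 hf2, Finset.sum_range_succ,
      measureReal_union hD measurableSet_Ioc hμ1 hμ2, add_sub_add_comm, mul_add]
    exact (abs_add_le _ _).trans (add_le_add ih hlast)

theorem tendsto_setIntegral_of_tendsto_measureReal_Ioc {μ : ℕ → Measure ℝ}
    [∀ n, IsFiniteMeasure (μ n)] {ν : Measure ℝ} {a b : ℝ} (hab : a ≤ b) (hν : ν (Ioc a b) ≠ ∞)
    (h : ∀ x y, a ≤ x → x ≤ y → y ≤ b →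
      Tendsto (fun n => (μ n).real (Ioc x y)) atTop (𝓝 (ν.real (Ioc x y))))
    {f : ℝ → ℝ} (hf : ContinuousOn f (Icc a b)) :
    Tendsto (fun n => ∫ x in Ioc a b, f x ∂μ n) atTop (𝓝 (∫ x in Ioc a b, f x ∂ν)) := by
  -- `M` bounds the mass under `ν` and eventually under `μ n`, so one Riemann-sum error `ε * M` fits
  -- all these measures.
  set M := ν.real (Ioc a b) + 1 with hM
  have hM0 : 0 < M := by positivity
  have hMev : ∀ᶠ n in atTop, (μ n).real (Ioc a b) ≤ M :=
    (h a b le_rfl hab le_rfl).eventually_le_const (by linarith)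
  suffices H : ∀ δ > 0, ∀ᶠ n in atTop,
      dist (∫ x in Ioc a b, f x ∂μ n) (∫ x in Ioc a b, f x ∂ν) < δ from
    Metric.tendsto_nhds.2 H
  intro δ hδ
  -- One share each for the Riemann-sum error under `μ n`, that under `ν`, and the gap between the
  -- two sums.
  obtain ⟨ε, hε, hδε⟩ : ∃ ε > 0, δ = 3 * (ε * M) := ⟨δ / 3 / M, by positivity, by field_simp⟩
  obtain ⟨η, hη, hunif⟩ := Metric.uniformContinuousOn_iff_le.1
    (isCompact_Icc.uniformContinuousOn_of_continuous hf) ε hε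
  obtain ⟨m, hm⟩ := exists_nat_gt ((b - a) / η)
  have hm0 : 0 < (m : ℝ) := lt_of_le_of_lt (div_nonneg (by linarith) hη.le) hm
  set t : ℕ → ℝ := fun i => a + i * ((b - a) / m) with htdef
  have hstep : 0 ≤ (b - a) / m := div_nonneg (by linarith) hm0.le
  have hstep' : (b - a) / m ≤ η := by
    rw [div_lt_iff₀ hη] at hm
    rw [div_le_iff₀ hm0]
    linarith
  have ht : Monotone t := fun i j hij => by
    have : (i : ℝ) ≤ j := by exact_mod_cast hij
    simp only [htdef]
    nlinarith
  have ht0 : t 0 = a := by simp [htdef]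
  have htm : t m = b := by simp only [htdef]; field_simp; ring
  have htmem {i : ℕ} (hi : i ≤ m) : t i ∈ Icc a b :=
    ⟨ht0 ▸ ht (Nat.zero_le i), htm ▸ ht hi⟩
  have hosc : ∀ i < m, ∀ x ∈ Ioc (t i) (t (i + 1)), |f x - f (t i)| ≤ ε := by
    intro i hi x hx
    refine hunif x ⟨(htmem hi.le).1.trans hx.1.le, hx.2.trans (htmem hi).2⟩ _ (htmem hi.le) ?_
    have : t (i + 1) = t i + (b - a) / m := by simp only [htdef]; push_cast; ring
    rw [Real.dist_eq, abs_of_nonneg (by linarith [hx.1])]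
    linarith [hx.2]
  have happrox (ρ : Measure ℝ) (hρ : ρ (Ioc a b) ≠ ∞) :
      |∫ x in Ioc a b, f x ∂ρ -
        ∑ i ∈ Finset.range m, f (t i) * ρ.real (Ioc (t i) (t (i + 1)))| ≤
        ε * ρ.real (Ioc a b) := by
    have hfi := integrableOn_Ioc_of_continuousOn hρ hf
    rw [← ht0, ← htm] at hρ hfi ⊢
    exact abs_setIntegral_sub_sum_le ht hρ hfi hosc
  have hsum : Tendsto
      (fun n => ∑ i ∈ Finset.range m, f (t i) * (μ n).real (Ioc (t i) (t (i + 1)))) atTop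
      (𝓝 (∑ i ∈ Finset.range m, f (t i) * ν.real (Ioc (t i) (t (i + 1))))) :=
    tendsto_finsetSum _ fun i hi => ((h _ _ (htmem (Finset.mem_range.1 hi).le).1
      (ht (Nat.le_succ i)) (htmem (Finset.mem_range.1 hi)).2).const_mul _)
  filter_upwards [hMev, Metric.tendsto_nhds.1 hsum (ε * M) (by positivity)] with n hn1 hn2
  have a1 := (happrox (μ n) (measure_ne_top _ _)).trans (mul_le_mul_of_nonneg_left hn1 hε.le)
  have a2 := (happrox ν hν).trans
    (mul_le_mul_of_nonneg_left (by linarith : ν.real (Ioc a b) ≤ M) hε.le)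
  rw [Real.dist_eq, abs_lt] at hn2 ⊢
  rw [abs_le] at a1 a2
  constructor <;> linarith [a1.1, a1.2, a2.1, a2.2]

theorem map_rescaled_real_Ioc (p : ℕ → ℝ) (n : ℕ) {x y : ℝ} (hx : 0 < x) (hy : y < 1) :
    ((rescaled p n).map Subtype.val).real (Ioc x y) =
      n * (empirical (stratified p) n).real (Ioc x y) / √(s p n) := by
  have hsub : Ioc x y ⊆ Ioo 0 1 := fun u hu => ⟨hx.trans hu.1, hu.2.trans_lt hy⟩
  rw [map_measureReal_apply measurable_subtype_coe measurableSet_Ioc, rescaled,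
    measureReal_ennreal_smul_apply, ENNReal.toReal_ofReal (by positivity), measureReal_def,
    comap_subtype_coe_apply measurableSet_Ioo, Subtype.image_preimage_coe, inter_eq_right.2 hsub,
    ← measureReal_def]
  ring

theorem exists_Ioc_of_isCompact {K : Set ℝ} (hK : IsCompact K) (hK1 : K ⊆ Ioo 0 1) :
    ∃ a b : ℝ, 0 < a ∧ a ≤ b ∧ b < 1 ∧ K ⊆ Ioc a b := by
  rcases K.eq_empty_or_nonempty with rfl | hne
  · exact ⟨1 / 2, 1 / 2, by norm_num, le_rfl, by norm_num, empty_subset _⟩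
  · obtain ⟨l, hl, hl'⟩ := hK.exists_isLeast hne
    obtain ⟨g, hg, hg'⟩ := hK.exists_isGreatest hne
    have hl0 := (hK1 hl).1
    -- `Ioc` omits its left end, so `a` must lie strictly below the minimum `l`.
    refine ⟨l / 2, g, by linarith, by linarith [hl' hg], (hK1 hg).2, fun x hx => ⟨?_, hg' hx⟩⟩
    linarith [hl' hx]

theorem vagueTendsto_rescaled {p : ℕ → ℝ} (hp : ∀ n, 1 ≤ n → p n ∈ Icc (0 : ℝ) 1)
    (hs : Tendsto (s p) atTop atTop) : VagueTendsto (rescaled p) limitMeasure := by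
  intro f
  have hemb : MeasurableEmbedding (Subtype.val : Ioo (0 : ℝ) 1 → ℝ) :=
    .subtype_coe measurableSet_Ioo
  obtain ⟨a, b, ha, hab, hb, hK⟩ := exists_Ioc_of_isCompact
    (f.hasCompactSupport.isCompact.image continuous_subtype_val) (by rintro _ ⟨x, -, rfl⟩; exact x.2)
  -- Extension by zero moves the integrals to `ℝ`, where the support lies in `Ioc a b`.
  set g : ℝ → ℝ := Function.extend Subtype.val f 0 with hg
  have hgf (x : Ioo (0 : ℝ) 1) : g x = f x := Subtype.val_injective.extend_apply _ _ _
  have hg0 : ∀ x, x ∉ Ioc a b → g x = 0 := by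
    intro x hx
    by_cases hxI : x ∈ Ioo (0 : ℝ) 1
    · refine (hgf ⟨x, hxI⟩).trans (image_eq_zero_of_notMem_tsupport fun hmem => hx (hK ?_))
      exact ⟨_, hmem, rfl⟩
    · exact Function.extend_apply' _ _ _ (by rintro ⟨y, rfl⟩; exact hxI y.2)
  have hgc : ContinuousOn g (Icc a b) := by
    have : ContinuousOn g (Ioo 0 1) := by
      rw [continuousOn_iff_continuous_domRestrict]
      exact f.continuous.congr fun x => (hgf x).symm
    exact this.mono fun x hx => ⟨ha.trans_le hx.1, hx.2.trans_lt hb⟩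
  have hint (ρ : Measure (Ioo (0 : ℝ) 1)) :
      ∫ x, f x ∂ρ = ∫ x in Ioc a b, g x ∂(ρ.map Subtype.val) := by
    rw [setIntegral_eq_integral_of_forall_compl_eq_zero hg0, hemb.integral_map]
    simp_rw [hgf]
  have hfin := isFiniteMeasure_rescaled p
  have hfin' (n : ℕ) : IsFiniteMeasure ((rescaled p n).map Subtype.val) := inferInstance
  simp_rw [hint]
  refine tendsto_setIntegral_of_tendsto_measureReal_Ioc hab ?_ (fun x y hax hxy hyb => ?_) hgc
  · rw [map_limitMeasure_Ioc ha hab hb]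
    exact ENNReal.ofReal_ne_top
  · have hx := ha.trans_le hax
    have hy := hyb.trans_lt hb
    simp_rw [map_rescaled_real_Ioc p _ hx hy]
    rw [measureReal_def, map_limitMeasure_Ioc hx hxy hy, ENNReal.toReal_ofReal
      (sub_nonneg.2 (Q_le_Q ⟨hx, hxy.trans_lt hy⟩ ⟨hx.trans_le hxy, hy⟩ hxy))]
    exact tendsto_mul_empirical_real_div hp hs hx hxy hy measurableSet_Ioc Ioo_subset_Ioc_self
      Ioc_subset_Icc_self

end FragErasure

theorem mainTheorem3 (p : ℕ → ℝ) (hp : ∀ n, 1 ≤ n → p n ∈ Set.Icc (0 : ℝ) 1)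
    (hs : Tendsto (FragErasure.s p) atTop atTop) :
    -- the density is a genuine nonnegative derivative
    (∀ u ∈ Set.Ioo (0 : ℝ) 1,
      DifferentiableAt ℝ FragErasure.Q u ∧ 0 ≤ deriv FragErasure.Q u) ∧
    -- all measures involved are Radon measures on the open unit interval
    (∀ n, (FragErasure.rescaled p n).Regular) ∧ FragErasure.limitMeasure.Regular ∧
    FragErasure.VagueTendsto (FragErasure.rescaled p) FragErasure.limitMeasure ∧
    ∀ x y : ℝ, 0 < x → x ≤ y → y < 1 →
      Tendsto (fun n : ℕ =>
          (n : ℝ) * (FragErasure.empirical (FragErasure.stratified p) n).real (Set.Icc x y)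
            / √(FragErasure.s p n))
        atTop (𝓝 (FragErasure.Q y - FragErasure.Q x)) :=
  ⟨fun _ hu => ⟨(FragErasure.hasDerivAt_Q hu).differentiableAt, FragErasure.deriv_Q_nonneg hu⟩,
    FragErasure.regular_rescaled p, FragErasure.regular_limitMeasure,
    FragErasure.vagueTendsto_rescaled hp hs, fun _ _ hx hxy hy =>
      FragErasure.tendsto_mul_empirical_real_div hp hs hx hxy hy measurableSet_Icc
        Set.Ioo_subset_Icc_self Set.Subset.rfl⟩
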